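/- A rectangular warehouse has $n$ vertical aisles with horizontal coordinates $x_1<\dots<x_n$ and $b+1$ horizontal cross-aisles with vertical coordinates $y_0<\dots<y_b$ (so $b$ blocks); the subaisle $k$ of an aisle is its segment between cross-aisles $k-1$ and $k$. A finite set of item locations is given, each in the interior of a subaisle, together with a depot, which is either an intersection of an aisle with a cross-aisle or one of the item locations. The pick locations are the items and the depot; an aisle is non-empty if it contains at least one pick location. Let $G$ be the graph whose vertices are all intersections and all item locations, and whose edges are the segments joining consecutive vertices of one aisle and the segments joining the intersections of one cross-aisle with consecutive aisles, each edge weighted by its length. A minimal tour is a closed walk in $G$ of minimum total length through all pick locations, regarded as the multiset $T$ of edges that it traverses. A double edge of $T$ is a segment of an aisle between two different cross-aisles (thus spanning one or more subaisles) all of whose edges are contained at least twice in $T$, such that no horizontal edge of $T$ is incident to an intersection strictly inside the segment. (Horizontal edges used twice, and subaisles of which only a part is traversed twice, are not double edges.) Then a minimal tour without any double edge exists in each of the following two cases: (i) single-block layouts ($b=1$), with any number of non-empty aisles; (ii) two-block layouts ($b=2$) with at least two non-empty aisles. -/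

import Mathlib

/-!
A rectangular warehouse with `n` vertical aisles and `b` blocks, i.e. `b + 1` horizontal
cross-aisles `0, …, b` numbered from the top.  Points of the warehouse carry two coordinates:
the horizontal coordinate of their aisle and their distance down the aisle.  The subaisle `k` of
an aisle is the segment between the cross-aisles `k` and `k + 1`.
-/

namespace Picker

/-- The floor plan and the pick list of a rectangular warehouse: the aisles have horizontal
coordinates `aislePos`, the cross-aisles have vertical coordinates `crossPos`, and `items i k` is
the finite set of vertical coordinates of the pick locations inside subaisle `k` of aisle `i`. -/
structure Layout (n b : ℕ) where
  aislePos : Fin n → ℝ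
  aislePos_strictMono : StrictMono aislePos
  crossPos : Fin (b + 1) → ℝ
  crossPos_strictMono : StrictMono crossPos
  items : Fin n → Fin b → Finset ℝ
  items_mem : ∀ i k, ∀ p ∈ items i k, crossPos k.castSucc < p ∧ p < crossPos k.succ

namespace Layout

variable {n b : ℕ}

/-- The vertices of the warehouse graph: the intersections of aisles with cross-aisles,
and the pick locations inside the subaisles. -/
inductive Vertex (L : Layout n b) : Type
  | cross (i : Fin n) (r : Fin (b + 1)) : Vertex L
  | item (i : Fin n) (k : Fin b) (p : ℝ) (hp : p ∈ L.items i k) : Vertex L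

/-- The aisle in which a vertex lies. -/
def Vertex.aisle {L : Layout n b} : L.Vertex → Fin n
  | .cross i _ => i
  | .item i _ _ _ => i

/-- The vertical coordinate of a vertex. -/
def Vertex.pos {L : Layout n b} : L.Vertex → ℝ
  | .cross _ r => L.crossPos r
  | .item _ _ p _ => p

/-- `u` and `v` are consecutive vertices of the same aisle, `u` above `v`. -/
def VertStep (L : Layout n b) (u v : L.Vertex) : Prop :=
  u.aisle = v.aisle ∧ u.pos < v.pos ∧
    ∀ x : L.Vertex, x.aisle = u.aisle → ¬ (u.pos < x.pos ∧ x.pos < v.pos)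

/-- `u` and `v` are the intersections of one cross-aisle with two consecutive aisles,
`u` to the left of `v`. -/
def HorizStep (L : Layout n b) (u v : L.Vertex) : Prop :=
  ∃ (i j : Fin n) (r : Fin (b + 1)), i.val + 1 = j.val ∧ u = .cross i r ∧ v = .cross j r

/-- The warehouse graph. -/
def graph (L : Layout n b) : SimpleGraph L.Vertex :=
  SimpleGraph.fromRel fun u v => L.VertStep u v ∨ L.HorizStep u v

/-- The length of an edge.  Edges are horizontal or vertical segments,
so this is the length of the segment. -/
noncomputable def edgeLength (L : Layout n b) : Sym2 L.Vertex → ℝ :=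
  Sym2.lift ⟨fun u v => |L.aislePos u.aisle - L.aislePos v.aisle| + |u.pos - v.pos|,
    fun u v => by simp only [abs_sub_comm]⟩

end Layout

/-- A rectangular warehouse with a pick list and a depot.  The depot is one of the vertices;
it is the only location to be visited that may lie at an intersection. -/
structure Warehouse (n b : ℕ) extends Layout n b where
  depot : toLayout.Vertex

namespace Warehouse

variable {n b : ℕ}

/-- The locations that have to be visited: the depot and all items on the pick list. -/
def IsPickLocation (W : Warehouse n b) (v : W.Vertex) : Prop :=
  v = W.depot ∨ ∃ i k p, ∃ hp : p ∈ W.items i k, v = .item i k p hp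

/-- An aisle is non-empty if it contains at least one pick location. -/
def NonemptyAisle (W : Warehouse n b) (i : Fin n) : Prop :=
  ∃ v : W.Vertex, W.IsPickLocation v ∧ v.aisle = i

/-- A tour subgraph, as a multiset of edges: it consists of the edges, counted with
multiplicity, traversed by a closed walk from the depot that visits all pick locations. -/
def IsTourSubgraph (W : Warehouse n b) (T : Multiset (Sym2 W.Vertex)) : Prop :=
  ∃ w : W.graph.Walk W.depot W.depot,
    (∀ v, W.IsPickLocation v → v ∈ w.support) ∧ T = (w.edges : Multiset (Sym2 W.Vertex))

/-- The total length of a multiset of edges. -/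
noncomputable def length (W : Warehouse n b) (T : Multiset (Sym2 W.Vertex)) : ℝ :=
  (T.map W.edgeLength).sum

/-- A minimal tour: a tour subgraph of minimum length. -/
def IsMinimalTour (W : Warehouse n b) (T : Multiset (Sym2 W.Vertex)) : Prop :=
  W.IsTourSubgraph T ∧ ∀ T', W.IsTourSubgraph T' → W.length T ≤ W.length T'

open Classical in
/-- `T` has a double edge in aisle `i` between the cross-aisles `r` and `s`: the whole segment
between them, which is one or more subaisles, is contained (at least) twice in `T`, and
no horizontal edge of `T` is incident to an intersection strictly in between. -/
def HasDoubleEdge (W : Warehouse n b) (T : Multiset (Sym2 W.Vertex))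
    (i : Fin n) (r s : Fin (b + 1)) : Prop :=
  r < s ∧
  (∀ u v : W.Vertex, W.VertStep u v → u.aisle = i →
    W.crossPos r ≤ u.pos → v.pos ≤ W.crossPos s → 2 ≤ T.count s(u, v)) ∧
  (∀ q : Fin (b + 1), r < q → q < s → ∀ v : W.Vertex,
    W.HorizStep (.cross i q) v ∨ W.HorizStep v (.cross i q) → s(.cross i q, v) ∉ T)

/-- `T` contains no double edge. -/
def NoDoubleEdge (W : Warehouse n b) (T : Multiset (Sym2 W.Vertex)) : Prop :=
  ∀ i r s, ¬ W.HasDoubleEdge T i r s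

end Warehouse

end Picker

/-!
By Euler's theorem a minimal tour is a shortest multiset of edges that meets every vertex an even
number of times and connects the depot with all pick locations.  Such a multiset can be changed
locally without having to keep track of a walk, and by minimality every edge that it uses twice is
a bridge and is used no more than twice.

Among the shortest ones take one with as few doubled subaisles as possible.  If a horizontal edge
is used at an end of a doubled subaisle, then one copy of the subaisle followed by this edge is one
of the two ways around a rectangle, and replacing it by the other way, which has the same length,
moves the doubled subaisle to the neighbouring aisle.  A doubled subaisle that ends at an outer
cross-aisle must end there at the depot: otherwise some horizontal edge leaves that end, by parity
there is one on both sides, and after either move the doubled subaisle has a pendant end, so that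
both neighbouring intersections would be the depot.  With a single block this is impossible, as
both cross-aisles are outer.  With two blocks it shows that no horizontal edge is used at either
end of the doubled subaisle and that the other subaisle of the aisle is not doubled.  Hence at most
one edge, used at most once, leaves some part of the aisle that contains the depot, and by parity
there is nothing to visit outside of this part, whereas a second aisle is non-empty.
-/

namespace Picker

open SimpleGraph Finsupp

section EvenConnector

variable {V : Type*} {G : SimpleGraph V} {S T : Multiset (Sym2 V)} {u v : V}

/-- The boundary of a multiset of edges modulo 2, a 0-chain with coefficients in `ZMod 2`: the sum
of the two ends of every edge, where a loop contributes nothing. -/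
noncomputable def boundary : Multiset (Sym2 V) →+ V →₀ ZMod 2 :=
  Multiset.sumAddMonoidHom.comp <| Multiset.mapAddMonoidHom <|
    Sym2.lift ⟨fun a b => single a 1 + single b 1, fun _ _ => add_comm _ _⟩

theorem boundary_singleton (a b : V) : boundary {s(a, b)} = single a 1 + single b 1 := by
  simp [boundary]

theorem boundary_cons (a b : V) (T : Multiset (Sym2 V)) :
    boundary (s(a, b) ::ₘ T) = single a 1 + single b 1 + boundary T := by
  rw [← Multiset.singleton_add, map_add, boundary_singleton]

theorem boundary_walk_edges (w : G.Walk u v) :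
    boundary (w.edges : Multiset (Sym2 V)) = single u 1 + single v 1 := by
  induction w with
  | nil => simp [ZModModule.add_self]
  | @cons a b c h p ih =>
    rw [Walk.edges_cons, ← Multiset.cons_coe, boundary_cons, ih, add_assoc,
      ← add_assoc (single b _), ZModModule.add_self, zero_add]

theorem boundary_eq_sum (T : Multiset (Sym2 V)) :
    boundary T = (T.map fun e => boundary {e}).sum := by
  simpa [Multiset.map_map, Function.comp_def] using map_multiset_sum boundary (T.map ({·}))

theorem exists_mem_of_boundary_apply_ne_zero (h : boundary T v ≠ 0) : ∃ e ∈ T, v ∈ e := by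
  contrapose! h
  induction T using Multiset.induction_on with
  | empty => simp
  | cons e T ih =>
    induction e with | _ a b
    have hv := h s(a, b) (Multiset.mem_cons_self _ _)
    rw [Sym2.mem_iff, not_or] at hv
    rw [boundary_cons, Finsupp.add_apply, Finsupp.add_apply, single_eq_of_ne hv.1,
      single_eq_of_ne hv.2, ih fun e he => h e (Multiset.mem_cons_of_mem he), add_zero, add_zero]

/-- The set of edges with exactly one end in `A`. -/
def cut (A : Set V) : Set (Sym2 V) := {e | ∃ a ∈ A, ∃ b ∉ A, e = s(a, b)}

theorem mk_mem_cut {A : Set V} {a b : V} : s(a, b) ∈ cut A ↔ ¬ (a ∈ A ↔ b ∈ A) := by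
  simp only [cut, Set.mem_ofPred_eq, Sym2.eq_iff]
  grind

theorem mem_of_mem_cut_singleton {e : Sym2 V} (he : e ∈ cut {v}) : v ∈ e := by
  obtain ⟨a, rfl, b, -, rfl⟩ := he
  exact Sym2.mem_mk_left _ _

open Classical in
theorem countP_cut_eq_linearCombination_boundary (A : Set V) (T : Multiset (Sym2 V)) :
    (T.countP (· ∈ cut A) : ZMod 2) = linearCombination (ZMod 2) (A.indicator 1) (boundary T) := by
  induction T using Multiset.induction_on with
  | empty => simp
  | cons e T ih =>
    induction e with | _ a b
    have hends : (if s(a, b) ∈ cut A then 1 else 0 : ZMod 2) =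
        A.indicator 1 a + A.indicator 1 b := by
      by_cases ha : a ∈ A <;> by_cases hb : b ∈ A <;>
        simp [mk_mem_cut, ha, hb, CharTwo.add_self_eq_zero]
    rw [Multiset.countP_cons, Nat.cast_add, ih, boundary_cons, map_add, map_add,
      linearCombination_single, linearCombination_single, one_smul, one_smul, ← hends, add_comm]
    push_cast
    rfl

open Classical in
theorem exists_odd_count_of_mem_cut (hT : boundary T = 0) {A : Set V} {e : Sym2 V}
    (he : e ∈ cut A) (hodd : Odd (T.count e)) : ∃ e' ∈ cut A, e' ≠ e ∧ Odd (T.count e') := by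
  set C := T.filter (· ∈ cut A) with hC
  have heven : Even C.card := by
    rw [← Multiset.countP_eq_card_filter, ← ZMod.natCast_eq_zero_iff_even,
      countP_cut_eq_linearCombination_boundary, hT, map_zero]
  rw [← Multiset.toFinset_sum_count_eq, Finset.even_sum_iff_even_card_odd] at heven
  have he' : e ∈ {e ∈ C.toFinset | Odd (C.count e)} := by
    simp [hC, he, hodd, Multiset.count_pos.1 hodd.pos]
  have hcard : 1 < ({e ∈ C.toFinset | Odd (C.count e)} : Finset _).card :=
    lt_of_le_of_ne (Finset.card_pos.2 ⟨e, he'⟩) fun h => by simp [← h] at heven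
  obtain ⟨e', he', hne⟩ := Finset.exists_mem_ne hcard e
  simp only [Finset.mem_filter, Multiset.mem_toFinset, hC, Multiset.mem_filter] at he'
  exact ⟨e', he'.1.2, hne, by simpa [he'.1.2] using he'.2⟩

/-- The graph formed by the edges that occur in `T`. -/
def usedGraph (T : Multiset (Sym2 V)) : SimpleGraph V := fromEdgeSet {e | e ∈ T}

theorem usedGraph_adj : (usedGraph T).Adj u v ↔ s(u, v) ∈ T ∧ u ≠ v := fromEdgeSet_adj _

theorem usedGraph_mono (h : S ⊆ T) : usedGraph S ≤ usedGraph T :=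
  fromEdgeSet_mono fun _ he => h he

theorem usedGraph_le (h : ∀ e ∈ T, e ∈ G.edgeSet) : usedGraph T ≤ G :=
  fun _ _ huv => h _ (usedGraph_adj.1 huv).1

theorem reachable_usedGraph_of_mem (h : s(u, v) ∈ T) : (usedGraph T).Reachable u v := by
  by_cases huv : u = v
  · exact huv ▸ .rfl
  · exact Adj.reachable ⟨h, huv⟩

theorem reachable_usedGraph_of_boundary_eq (h : boundary T = single u 1 + single v 1) :
    (usedGraph T).Reachable u v := by
  classical
  by_contra huv
  have hcut := countP_cut_eq_linearCombination_boundary {x | (usedGraph T).Reachable u x} T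
  rw [Multiset.countP_eq_zero.2, h] at hcut
  · simp [huv] at hcut
  · rintro _ he ⟨a, ha, b, hb, rfl⟩
    exact hb (Reachable.trans ha (reachable_usedGraph_of_mem he))

open Classical in
theorem even_count_of_isBridge {e : Sym2 V} (he : (usedGraph T).IsBridge e) (hST : S ⊆ T)
    (hS : boundary S = 0) : Even (S.count e) := by
  induction e with | _ a b
  by_contra hodd
  obtain ⟨_, ⟨x, hx, y, hy, rfl⟩, hne, hxy⟩ := exists_odd_count_of_mem_cut hS
    (A := {x | ((usedGraph T).deleteEdges {s(a, b)}).Reachable a x})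
    ⟨a, Reachable.refl _, b, he, rfl⟩ (Nat.not_even_iff_odd.1 hodd)
  have hxyT : (usedGraph T).Adj x y :=
    usedGraph_adj.2 ⟨hST (Multiset.count_pos.1 hxy.pos), fun h => hy (h ▸ hx)⟩
  exact hy (Reachable.trans hx (deleteEdges_adj.2 ⟨hxyT, hne⟩).reachable)

theorem reachable_usedGraph_walk_edges (w : G.Walk u v) {x : V} (hx : x ∈ w.support) :
    (usedGraph (w.edges : Multiset (Sym2 V))).Reachable u x := by
  classical
  exact (reachable_usedGraph_of_boundary_eq (boundary_walk_edges (w.takeUntil x hx))).mono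
    (usedGraph_mono (w.edges_takeUntil_subset_edges hx))

theorem reachable_of_adj_reachable {V' : Type*} {G' : SimpleGraph V'} (f : V → V')
    (hf : ∀ a b, G.Adj a b → G'.Reachable (f a) (f b)) (h : G.Reachable u v) :
    G'.Reachable (f u) (f v) := by
  obtain ⟨w⟩ := h
  induction w with
  | nil => rfl
  | cons hadj _ ih => exact (hf _ _ hadj).trans ih

theorem length_le_card_of_edges_le {w : G.Walk u v} (hw : (w.edges : Multiset (Sym2 V)) ≤ T) :
    w.length ≤ T.card := by
  simpa using Multiset.card_le_card hw

theorem exists_closed_walk_edges_le (hG : ∀ e ∈ T, e ∈ G.edgeSet) (hT : boundary T = 0)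
    (huv : s(u, v) ∈ T) :
    ∃ c : G.Walk u u, 0 < c.length ∧ (c.edges : Multiset (Sym2 V)) ≤ T := by
  classical
  obtain ⟨⟨x, w⟩, hwT, hmax⟩ := Set.Finite.exists_maximalFor'
    (fun w : Σ x, G.Walk u x => w.2.length) {w | (w.2.edges : Multiset (Sym2 V)) ≤ T}
    ((Set.finite_Iic T.card).subset <| Set.image_subset_iff.2 fun _ => length_le_card_of_edges_le)
    ⟨⟨u, .nil⟩, by simp⟩
  have hlongest : ∀ y (p : G.Walk u y), (p.edges : Multiset (Sym2 V)) ≤ T → p.length ≤ w.length :=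
    fun y p hp => (le_total _ _).elim id (hmax (j := ⟨y, p⟩) hp)
  have hpos : 0 < w.length := hlongest v (.cons (hG _ huv) .nil) (Multiset.singleton_le.2 huv)
  suffices u = x by
    subst this
    exact ⟨w, hpos, hwT⟩
  by_contra hux
  obtain ⟨R, rfl⟩ := Multiset.le_iff_exists_add.1 (Set.mem_ofPred.1 hwT)
  have hR : boundary R = single u 1 + single x 1 := by
    rwa [map_add, boundary_walk_edges, ← ZModModule.sub_eq_add, sub_eq_zero, eq_comm] at hT
  obtain ⟨e, heR, hxe⟩ : ∃ e ∈ R, x ∈ e :=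
    exists_mem_of_boundary_apply_ne_zero (by simp [hR, single_eq_of_ne' hux])
  obtain ⟨y, rfl⟩ := hxe
  have hxy : G.Adj x y := hG _ (Multiset.mem_add.2 (.inr heR))
  have hlen := hlongest y (w.concat hxy) (by
    rw [Walk.edges_concat, List.concat_eq_append, ← Multiset.coe_add]
    simpa using heR)
  simp at hlen

/-- `T` is a multiset of edges of `G` that meets every vertex an even number of times and connects
`d` with all of `P`.  It may have further components, so it need not be traversed by one walk;
this makes the notion stable under local changes of `T`. -/
structure IsEvenConnector (G : SimpleGraph V) (d : V) (P : Set V) (T : Multiset (Sym2 V)) :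
    Prop where
  mem_edgeSet : ∀ e ∈ T, e ∈ G.edgeSet
  boundary_eq_zero : boundary T = 0
  reachable : ∀ v ∈ P, (usedGraph T).Reachable d v

theorem isEvenConnector_walk_edges {d : V} {P : Set V} (w : G.Walk d d)
    (hP : ∀ v ∈ P, v ∈ w.support) : IsEvenConnector G d P (w.edges : Multiset (Sym2 V)) where
  mem_edgeSet _ he := w.edges_subset_edgeSet he
  boundary_eq_zero := by rw [boundary_walk_edges, ZModModule.add_self]
  reachable v hv := reachable_usedGraph_walk_edges w (hP v hv)

namespace IsEvenConnector

variable {d : V} {P : Set V} {A B R : Multiset (Sym2 V)} {e : Sym2 V}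

/-- This is Euler's argument: a longest closed walk at `d` can be extended by a closed walk through
any unused edge that it meets. -/
theorem exists_walk_edges_le (hT : IsEvenConnector G d P T) :
    ∃ w : G.Walk d d, (∀ v ∈ P, v ∈ w.support) ∧ (w.edges : Multiset (Sym2 V)) ≤ T := by
  classical
  obtain ⟨w, hwT, hmax⟩ := Set.Finite.exists_maximalFor'
    (fun w : G.Walk d d => w.length) {w | (w.edges : Multiset (Sym2 V)) ≤ T}
    ((Set.finite_Iic T.card).subset <| Set.image_subset_iff.2 fun _ => length_le_card_of_edges_le)
    ⟨.nil, by simp⟩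
  have hlongest : ∀ p : G.Walk d d, (p.edges : Multiset (Sym2 V)) ≤ T → p.length ≤ w.length :=
    fun p hp => (le_total _ _).elim id (hmax hp)
  refine ⟨w, fun v hv => ?_, hwT⟩
  by_contra hvw
  obtain ⟨p⟩ := hT.reachable v hv
  obtain ⟨⟨⟨a, b⟩, habT, _⟩, -, ha, hb⟩ :=
    p.exists_boundary_dart {x | x ∈ w.support} w.start_mem_support hvw
  obtain ⟨R, rfl⟩ := Multiset.le_iff_exists_add.1 (Set.mem_ofPred.1 hwT)
  have habR : s(a, b) ∈ R := (Multiset.mem_add.1 habT).resolve_left fun h =>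
    hb (w.snd_mem_support_of_mem_edges h)
  obtain ⟨c, hc, hcR⟩ := exists_closed_walk_edges_le (G := G)
    (fun e he => hT.mem_edgeSet e (Multiset.mem_add.2 (.inr he)))
    (by simpa [boundary_walk_edges, ZModModule.add_self] using hT.boundary_eq_zero) habR
  set w' := ((w.takeUntil a ha).append c).append (w.dropUntil a ha)
  have hw' : (w'.edges : Multiset (Sym2 V)) = w.edges + c.edges := by
    have hsplit : (w.takeUntil a ha).edges ++ (w.dropUntil a ha).edges = w.edges := by
      rw [← Walk.edges_append, w.take_spec ha]
    rw [← hsplit, ← Multiset.coe_add]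
    simp only [w', Walk.edges_append, ← Multiset.coe_add, add_right_comm]
  have hlen : w'.length = w.length + c.length := by simpa using congrArg Multiset.card hw'
  have hle : w'.length ≤ w.length := hlongest w' (hw'.trans_le (by gcongr))
  omega

open Classical in
/-- By parity, the single edge `e` across the cut cannot be used exactly once. -/
theorem subset_of_cut (hT : IsEvenConnector G d P T) {A : Set V} (hd : d ∈ A)
    (hA : ∀ e' ∈ T, e' ∈ cut A → e' = e) (he : T.count e < 2) : P ⊆ A := by
  intro v hv
  by_contra hvA
  obtain ⟨p⟩ := hT.reachable v hv
  obtain ⟨⟨⟨a, b⟩, habT, _⟩, -, ha, hb⟩ := p.exists_boundary_dart A hd hvA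
  have hcut : s(a, b) ∈ cut A := ⟨a, ha, b, hb, rfl⟩
  obtain rfl := hA _ habT hcut
  have hpos : 0 < T.count s(a, b) := Multiset.count_pos.2 habT
  have hone : T.count s(a, b) = 1 := le_antisymm (Nat.lt_succ_iff.1 he) hpos
  obtain ⟨e', he', hne, hodd⟩ := exists_odd_count_of_mem_cut hT.boundary_eq_zero hcut
    (hone ▸ odd_one)
  exact hne (hA e' (Multiset.count_pos.1 hodd.pos) he')

theorem of_add_pair (hT : IsEvenConnector G d P (R + {e, e}))
    (h : ∀ v ∈ P, (usedGraph R).Reachable d v) : IsEvenConnector G d P R where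
  mem_edgeSet e' he' := hT.mem_edgeSet e' (Multiset.mem_add.2 (.inl he'))
  boundary_eq_zero := by
    simpa only [map_add, Multiset.insert_eq_cons, ← Multiset.singleton_add, ZModModule.add_self,
      add_zero] using hT.boundary_eq_zero
  reachable := h

theorem exchange (hT : IsEvenConnector G d P (R + A)) (hB : ∀ e ∈ B, e ∈ G.edgeSet)
    (hAB : boundary A = boundary B)
    (h : ∀ a b, s(a, b) ∈ A → (usedGraph (R + B)).Reachable a b) :
    IsEvenConnector G d P (R + B) where
  mem_edgeSet e he := (Multiset.mem_add.1 he).elim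
    (fun heR => hT.mem_edgeSet e (Multiset.mem_add.2 (.inl heR))) (hB e)
  boundary_eq_zero := by rw [map_add, ← hAB, ← map_add, hT.boundary_eq_zero]
  reachable v hv := reachable_of_adj_reachable id
    (fun a b hab => (Multiset.mem_add.1 (usedGraph_adj.1 hab).1).elim
      (fun habR => reachable_usedGraph_of_mem (Multiset.mem_add.2 (.inl habR))) (h a b))
    (hT.reachable v hv)

theorem two_nsmul_edgeFinset [Fintype G.edgeSet] (h : ∀ v ∈ P, G.Reachable d v) :
    IsEvenConnector G d P (2 • G.edgeFinset.val) where
  mem_edgeSet e he := by simpa using Multiset.mem_of_mem_nsmul he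
  boundary_eq_zero := by rw [map_nsmul, ZModModule.char_nsmul_eq_zero 2]
  reachable v hv := reachable_of_adj_reachable id
    (fun a b hab => reachable_usedGraph_of_mem <|
      Multiset.mem_nsmul.2 ⟨two_ne_zero, by simpa using hab⟩) (h v hv)

end IsEvenConnector

section Minimal

variable {d : V} {P : Set V} {R : Multiset (Sym2 V)} {e : Sym2 V}

open IsEvenConnector

theorem exists_not_reachable_of_minimal (hT : Minimal (IsEvenConnector G d P) (R + {e, e})) :
    ∃ v ∈ P, ¬ (usedGraph R).Reachable d v := by
  by_contra! h
  have hcard := Multiset.card_le_card (hT.2 (hT.prop.of_add_pair h) (Multiset.le_add_right _ _))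
  simp at hcard

theorem exists_walk_edges_eq_of_minimal (hT : Minimal (IsEvenConnector G d P) T) :
    ∃ w : G.Walk d d, (∀ v ∈ P, v ∈ w.support) ∧ T = (w.edges : Multiset (Sym2 V)) := by
  obtain ⟨w, hP, hw⟩ := hT.prop.exists_walk_edges_le
  exact ⟨w, hP, (hT.eq_of_le (isEvenConnector_walk_edges w hP) hw).symm⟩

open Classical in
theorem exists_eq_add_pair (he : 2 ≤ T.count e) : ∃ R, T = R + {e, e} := by
  obtain ⟨R, rfl⟩ := Multiset.le_iff_exists_add.1 (Multiset.le_count_iff_replicate_le.1 he)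
  exact ⟨R, add_comm _ _⟩

open Classical in
theorem count_le_two_of_minimal (hT : Minimal (IsEvenConnector G d P) T) (e : Sym2 V) :
    T.count e ≤ 2 := by
  by_contra! h
  obtain ⟨R, rfl⟩ := exists_eq_add_pair h.le
  have heR : e ∈ R := by
    rw [← Multiset.count_pos]
    simpa using h
  obtain ⟨v, hv, hdv⟩ := exists_not_reachable_of_minimal hT
  refine hdv ((hT.prop.reachable v hv).mono (usedGraph_mono ?_))
  intro e' he'
  simp only [Multiset.mem_add, Multiset.insert_eq_cons, Multiset.mem_cons, Multiset.mem_singleton,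
    or_self] at he'
  exact he'.elim id fun h => h ▸ heR

open Classical in
theorem isBridge_of_two_le_count (hT : Minimal (IsEvenConnector G d P) T) (he : 2 ≤ T.count e) :
    (usedGraph T).IsBridge e := by
  obtain ⟨R, rfl⟩ := exists_eq_add_pair he
  induction e with | _ a b
  intro h
  obtain ⟨v, hv, hdv⟩ := exists_not_reachable_of_minimal hT
  have hR : (usedGraph (R + {s(a, b), s(a, b)})).deleteEdges {s(a, b)} ≤ usedGraph R := by
    intro x y hxy
    simp only [deleteEdges_adj, usedGraph_adj, Set.mem_singleton_iff] at hxy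
    exact usedGraph_adj.2 ⟨by simpa [hxy.2] using hxy.1.1, hxy.1.2⟩
  refine hdv (reachable_of_adj_reachable id (fun x y hxy => ?_) (hT.prop.reachable v hv))
  by_cases hxyR : s(x, y) ∈ R
  · exact reachable_usedGraph_of_mem hxyR
  · have hends : s(x, y) = s(a, b) := by simpa [hxyR] using (usedGraph_adj.1 hxy).1
    obtain ⟨rfl, rfl⟩ | ⟨rfl, rfl⟩ := Sym2.eq_iff.1 hends
    exacts [h.mono hR, (h.mono hR).symm]

open Classical in
/-- Retracting the pendant vertex `c` to its neighbour `x` shows that the pendant edge could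
otherwise be dropped. -/
theorem mem_of_pendant_of_two_le_count (hT : Minimal (IsEvenConnector G d P) T)
    (he : 2 ≤ T.count e) {c : V} (hce : c ∈ e) (hc : ∀ e' ∈ T, c ∈ e' → e' = e) (hcd : c ≠ d) :
    c ∈ P := by
  by_contra hcP
  obtain ⟨R, rfl⟩ := exists_eq_add_pair he
  obtain ⟨x, rfl⟩ := hce
  obtain ⟨v, hv, hdv⟩ := exists_not_reachable_of_minimal hT
  have hcx : c ≠ x := Adj.ne (hT.prop.mem_edgeSet s(c, x) (by simp))
  have hfix : ∀ y, y ≠ c → Function.update id c x y = y := fun y hy => Function.update_of_ne hy _ _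
  refine hdv ?_
  rw [← hfix d hcd.symm, ← hfix v (ne_of_mem_of_not_mem hv hcP)]
  refine reachable_of_adj_reachable _ (fun a b hab => ?_) (hT.prop.reachable v hv)
  have habT := (usedGraph_adj.1 hab).1
  by_cases hab : c ∈ s(a, b)
  · obtain ⟨rfl, rfl⟩ | ⟨rfl, rfl⟩ := Sym2.eq_iff.1 (hc _ habT hab) <;>
      rw [Function.update_self, hfix _ hcx.symm]
  · have hne : s(a, b) ≠ s(c, x) := fun h => hab (h ▸ Sym2.mem_mk_left c x)
    rw [Sym2.mem_iff, not_or] at hab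
    rw [hfix a (Ne.symm hab.1), hfix b (Ne.symm hab.2)]
    exact reachable_usedGraph_of_mem (by simpa [hne] using habT)

end Minimal

section Weight

variable {d : V} {P : Set V} {ℓ : Sym2 V → ℝ}

theorem sum_map_lt_sum_map_of_lt {α : Type*} {f : α → ℝ} {s t : Multiset α}
    (hf : ∀ a ∈ t, 0 < f a) (hst : s < t) : (s.map f).sum < (t.map f).sum := by
  obtain ⟨a, hst⟩ := Multiset.lt_iff_cons_le.1 hst
  obtain ⟨u, rfl⟩ := Multiset.le_iff_exists_add.1 hst
  have ha : 0 < f a := hf a (by simp)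
  have hu : 0 ≤ (u.map f).sum := by
    refine Multiset.sum_nonneg fun y hy => ?_
    obtain ⟨b, hb, rfl⟩ := Multiset.mem_map.1 hy
    exact (hf b (by simp [hb])).le
  rw [Multiset.map_add, Multiset.sum_add, Multiset.map_cons, Multiset.sum_cons]
  linarith

theorem strictMonoOn_sum_map (hℓ : ∀ e ∈ G.edgeSet, 0 < ℓ e) :
    StrictMonoOn (fun T => (T.map ℓ).sum) {T | IsEvenConnector G d P T} :=
  fun _ _ _ hT hlt => sum_map_lt_sum_map_of_lt (fun e he => hℓ e (hT.mem_edgeSet e he)) hlt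

theorem finite_setOf_minimal_isEvenConnector [Finite V] :
    {T | Minimal (IsEvenConnector G d P) T}.Finite := by
  classical
  have := Fintype.ofFinite V
  refine (Set.finite_Icc 0 (2 • (Finset.univ : Finset (Sym2 V)).val)).subset fun T hT =>
    ⟨Multiset.zero_le _, Multiset.le_iff_count.2 fun e => ?_⟩
  simpa [Multiset.count_nsmul] using count_le_two_of_minimal hT e

theorem exists_minimalFor_sum [Finite V] (hℓ : ∀ e ∈ G.edgeSet, 0 < ℓ e)
    (h : ∀ v ∈ P, G.Reachable d v) :
    ∃ T, MinimalFor (IsEvenConnector G d P) (fun T => (T.map ℓ).sum) T := by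
  have := Fintype.ofFinite G.edgeSet
  obtain ⟨T₀, -, hT₀⟩ := exists_minimal_le_of_wellFoundedLT _ _
    (IsEvenConnector.two_nsmul_edgeFinset h)
  obtain ⟨T, hT, hmin⟩ := Set.exists_min_image _ (fun T : Multiset (Sym2 V) => (T.map ℓ).sum)
    finite_setOf_minimal_isEvenConnector ⟨T₀, hT₀⟩
  refine ⟨T, hT.prop, fun T' hT' _ => ?_⟩
  obtain ⟨T'', hle, hT''⟩ := exists_minimal_le_of_wellFoundedLT _ _ hT'
  exact (hmin T'' hT'').trans ((strictMonoOn_sum_map hℓ).monotoneOn hT''.prop hT' hle)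

end Weight

end EvenConnector

namespace Layout

variable {n b : ℕ} {L : Layout n b} {u v x y : L.Vertex} {e : Sym2 L.Vertex}
  {i j : Fin n} {k l : Fin b} {r r' : Fin (b + 1)}

section Aisle

instance : Finite L.Vertex := by
  refine Finite.of_surjective (fun x : (Fin n × Fin (b + 1)) ⊕
      (Σ i : Fin n, Σ k : Fin b, {p // p ∈ L.items i k}) =>
    x.elim (fun y => Vertex.cross y.1 y.2) fun y => Vertex.item y.1 y.2.1 y.2.2.1 y.2.2.2) ?_
  rintro (⟨i, r⟩ | ⟨i, k, p, hp⟩)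
  · exact ⟨.inl (i, r), rfl⟩
  · exact ⟨.inr ⟨i, k, p, hp⟩, rfl⟩

theorem le_or_ge_of_crossPos (L : Layout n b) (r : Fin (b + 1)) (k : Fin b) :
    L.crossPos r ≤ L.crossPos k.castSucc ∨ L.crossPos k.succ ≤ L.crossPos r := by
  rw [L.crossPos_strictMono.le_iff_le, L.crossPos_strictMono.le_iff_le,
    ← Fin.castSucc_lt_iff_succ_le]
  exact le_or_gt _ _

theorem subaisle_unique {p : ℝ} (hk : L.crossPos k.castSucc < p) (hk' : p ≤ L.crossPos k.succ)
    (hl : L.crossPos l.castSucc < p) (hl' : p ≤ L.crossPos l.succ) : k = l := by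
  have hkl := hk.trans_le hl'
  have hlk := hl.trans_le hk'
  rw [L.crossPos_strictMono.lt_iff_lt, Fin.castSucc_lt_succ_iff] at hkl hlk
  exact le_antisymm hkl hlk

theorem Vertex.ext_pos (haisle : u.aisle = v.aisle) (hpos : u.pos = v.pos) : u = v := by
  rcases u with ⟨i, r⟩ | ⟨i, k, p, hp⟩ <;> rcases v with ⟨j, s⟩ | ⟨j, l, q, hq⟩ <;>
    simp only [Vertex.aisle, Vertex.pos] at haisle hpos
  · rw [haisle, L.crossPos_strictMono.injective hpos]
  · have := L.items_mem j l q hq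
    rcases L.le_or_ge_of_crossPos r l with h | h <;> linarith
  · have := L.items_mem i k p hp
    rcases L.le_or_ge_of_crossPos s k with h | h <;> linarith
  · subst haisle hpos
    have hpk := L.items_mem i k p hp
    have hpl := L.items_mem i l p hq
    obtain rfl := subaisle_unique hpk.1 hpk.2.le hpl.1 hpl.2.le
    rfl

theorem Vertex.pos_le_last (v : L.Vertex) : v.pos ≤ L.crossPos (Fin.last b) := by
  rcases v with ⟨_, s⟩ | ⟨j, l, q, hq⟩
  · exact L.crossPos_strictMono.monotone (Fin.le_last s)
  · exact (L.items_mem j l q hq).2.le.trans (L.crossPos_strictMono.monotone (Fin.le_last _))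

theorem VertStep.adj (h : L.VertStep u v) : L.graph.Adj u v :=
  (fromRel_adj _ _ _).2 ⟨fun huv => h.2.1.ne (by rw [huv]), .inl (.inl h)⟩

theorem VertStep.edgeLength_eq (h : L.VertStep u v) : L.edgeLength s(u, v) = v.pos - u.pos := by
  simp only [edgeLength, Sym2.lift_mk, h.1, sub_self, abs_zero, zero_add]
  rw [abs_sub_comm, abs_of_pos (sub_pos.2 h.2.1)]

theorem VertStep.eq_of_mk_eq (h : L.VertStep u v) (h' : L.VertStep x y)
    (he : s(u, v) = s(x, y)) : u = x ∧ v = y := by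
  rcases Sym2.eq_iff.1 he with h1 | ⟨rfl, rfl⟩
  · exact h1
  · exact absurd h.2.1 h'.2.1.not_gt

theorem VertStep.eq_of_le_of_lt (h : L.VertStep u v) (h' : L.VertStep x y)
    (haisle : u.aisle = x.aisle) (hux : u.pos ≤ x.pos) (hxv : x.pos < v.pos) :
    u = x ∧ v = y := by
  obtain rfl : u = x := Vertex.ext_pos haisle <|
    hux.eq_of_not_lt fun hlt => h.2.2 x haisle.symm ⟨hlt, hxv⟩
  refine ⟨rfl, Vertex.ext_pos (h.1.symm.trans h'.1) (le_antisymm ?_ ?_)⟩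
  · exact not_lt.1 fun hlt => h.2.2 y h'.1.symm ⟨h'.2.1, hlt⟩
  · exact not_lt.1 fun hlt => h'.2.2 v h.1.symm ⟨h.2.1, hlt⟩

theorem exists_vertStep (haisle : u.aisle = v.aisle) (hlt : u.pos < v.pos) :
    ∃ x, L.VertStep u x ∧ x.pos ≤ v.pos := by
  obtain ⟨x, ⟨hxu, hux⟩, hmin⟩ := Set.exists_min_image
    {x : L.Vertex | x.aisle = u.aisle ∧ u.pos < x.pos} Vertex.pos (Set.toFinite _)
    ⟨v, haisle.symm, hlt⟩
  exact ⟨x, ⟨hxu.symm, hux, fun y hy h => (hmin y ⟨hy, h.1⟩).not_gt h.2⟩,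
    hmin v ⟨haisle.symm, hlt⟩⟩

/-- The edges of the segment of an aisle that goes from `u` down to `v`. -/
noncomputable def vertEdges (u v : L.Vertex) : Finset (Sym2 L.Vertex) :=
  {e | ∃ x y, L.VertStep x y ∧ x.aisle = u.aisle ∧ u.pos ≤ x.pos ∧ y.pos ≤ v.pos ∧
    e = s(x, y)}.toFinite.toFinset

theorem mem_vertEdges : e ∈ vertEdges u v ↔ ∃ x y, L.VertStep x y ∧ x.aisle = u.aisle ∧
    u.pos ≤ x.pos ∧ y.pos ≤ v.pos ∧ e = s(x, y) := by
  simp [vertEdges]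

theorem vertEdges_subset_edgeSet (he : e ∈ vertEdges u v) : e ∈ L.graph.edgeSet := by
  obtain ⟨x, y, hxy, -, -, -, rfl⟩ := mem_vertEdges.1 he
  exact hxy.adj

theorem vertEdges_eq_empty (h : v.pos ≤ u.pos) : vertEdges u v = ∅ := by
  refine Finset.eq_empty_of_forall_notMem fun e he => ?_
  obtain ⟨x, y, hxy, -, hux, hyv, -⟩ := mem_vertEdges.1 he
  exact (hux.trans_lt hxy.2.1).not_ge (hyv.trans h)

theorem VertStep.mk_notMem_vertEdges (h : L.VertStep u x) : s(u, x) ∉ vertEdges x v := by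
  intro hmem
  obtain ⟨a, c, hac, -, hxa, -, he⟩ := mem_vertEdges.1 hmem
  obtain ⟨rfl, -⟩ := h.eq_of_mk_eq hac he
  exact h.2.1.not_ge hxa

theorem VertStep.vertEdges_eq_cons (h : L.VertStep u x) (hxv : x.pos ≤ v.pos) :
    vertEdges u v = (vertEdges x v).cons s(u, x) h.mk_notMem_vertEdges := by
  ext e
  simp only [Finset.mem_cons, mem_vertEdges]
  constructor
  · rintro ⟨a, c, hac, haisle, hua, hcv, rfl⟩
    rcases lt_or_ge a.pos x.pos with hax | hxa
    · obtain ⟨rfl, rfl⟩ := h.eq_of_le_of_lt hac haisle.symm hua hax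
      exact .inl rfl
    · exact .inr ⟨a, c, hac, haisle.trans h.1, hxa, hcv, rfl⟩
  · rintro (rfl | ⟨a, c, hac, haisle, hxa, hcv, rfl⟩)
    · exact ⟨u, x, h, rfl, le_rfl, hxv, rfl⟩
    · exact ⟨a, c, hac, haisle.trans h.1.symm, h.2.1.le.trans hxa, hcv, rfl⟩

theorem sum_vertEdges {M : Type*} [AddCommGroup M] {f : Sym2 L.Vertex → M} (φ : L.Vertex → M)
    (hf : ∀ x y, L.VertStep x y → f s(x, y) = φ y - φ x) (haisle : u.aisle = v.aisle)
    (hle : u.pos ≤ v.pos) : ∑ e ∈ vertEdges u v, f e = φ v - φ u := by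
  have hwf : WellFounded fun x y : L.Vertex => y.pos < x.pos :=
    (@Finite.to_wellFoundedGT L.Vertex _ (Preorder.lift Vertex.pos)).wf
  induction u using hwf.induction with | _ u ih
  rcases hle.eq_or_lt with heq | hlt
  · rw [vertEdges_eq_empty heq.ge, Vertex.ext_pos haisle heq, sub_self, Finset.sum_empty]
  · obtain ⟨x, hux, hxv⟩ := exists_vertStep haisle hlt
    rw [hux.vertEdges_eq_cons hxv, Finset.sum_cons, hf u x hux,
      ih x hux.2.1 (hux.1.symm.trans haisle) hxv, add_comm, sub_add_sub_cancel]

theorem sum_edgeLength_vertEdges (haisle : u.aisle = v.aisle) (hle : u.pos ≤ v.pos) :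
    ∑ e ∈ vertEdges u v, L.edgeLength e = v.pos - u.pos :=
  sum_vertEdges Vertex.pos (fun _ _ h => h.edgeLength_eq) haisle hle

theorem boundary_vertEdges (haisle : u.aisle = v.aisle) (hle : u.pos ≤ v.pos) :
    boundary (vertEdges u v).val = single u 1 + single v 1 := by
  rw [boundary_eq_sum, Finset.sum_map_val, sum_vertEdges (single · 1) (fun x y _ => ?_) haisle hle,
    ZModModule.sub_eq_add, add_comm]
  rw [boundary_singleton, ZModModule.sub_eq_add, add_comm]

theorem reachable_of_aisle_eq (haisle : u.aisle = v.aisle) (hle : u.pos ≤ v.pos) :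
    L.graph.Reachable u v :=
  (reachable_usedGraph_of_boundary_eq (boundary_vertEdges haisle hle)).mono
    (usedGraph_le fun _ => vertEdges_subset_edgeSet)

end Aisle

section Subaisle

/-- The cross-aisles at the ends of subaisle `k` are `r` and `r'`, in either order. -/
def IsEnds (k : Fin b) (r r' : Fin (b + 1)) : Prop := s(r, r') = s(k.castSucc, k.succ)

theorem isEnds_castSucc_succ (k : Fin b) : IsEnds k k.castSucc k.succ := rfl

theorem IsEnds.symm (h : IsEnds k r r') : IsEnds k r' r := Sym2.eq_swap.trans h

theorem IsEnds.ne (h : IsEnds k r r') : r ≠ r' := by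
  rintro rfl
  have hdiag : s(k.castSucc, k.succ).IsDiag := h ▸ Sym2.mk_isDiag_iff.2 rfl
  exact k.castSucc_lt_succ.ne (Sym2.mk_isDiag_iff.1 hdiag)

/-- Cross-aisle `r` is the first or the last one, so it bounds only one subaisle of an aisle. -/
def IsOuter (r : Fin (b + 1)) : Prop := r = 0 ∨ r = Fin.last b

theorem IsOuter.eq_of_isEnds {s s' : Fin (b + 1)} (hr : IsOuter r) (hk : IsEnds k r s)
    (hl : IsEnds l r s') : k = l := by
  unfold IsEnds at hk hl
  simp only [IsOuter, Sym2.eq_iff, Fin.ext_iff, Fin.val_castSucc, Fin.val_succ, Fin.val_last,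
    Fin.val_zero] at hr hk hl ⊢
  omega

/-- The edges of subaisle `k` of aisle `i`. -/
noncomputable def subaisle (L : Layout n b) (i : Fin n) (k : Fin b) : Finset (Sym2 L.Vertex) :=
  vertEdges (.cross i k.castSucc) (.cross i k.succ)

theorem mem_subaisle : e ∈ L.subaisle i k ↔ ∃ x y, L.VertStep x y ∧ x.aisle = i ∧
    L.crossPos k.castSucc ≤ x.pos ∧ y.pos ≤ L.crossPos k.succ ∧ e = s(x, y) :=
  mem_vertEdges

theorem subaisle_subset_edgeSet (he : e ∈ L.subaisle i k) : e ∈ L.graph.edgeSet :=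
  vertEdges_subset_edgeSet he

theorem sum_edgeLength_subaisle (L : Layout n b) (i : Fin n) (k : Fin b) :
    ∑ e ∈ L.subaisle i k, L.edgeLength e = L.crossPos k.succ - L.crossPos k.castSucc :=
  sum_edgeLength_vertEdges rfl (L.crossPos_strictMono k.castSucc_lt_succ).le

theorem boundary_subaisle (L : Layout n b) (i : Fin n) (h : IsEnds k r r') :
    boundary (L.subaisle i k).val = single (.cross i r) 1 + single (.cross i r') 1 := by
  have hk := boundary_vertEdges (u := .cross i k.castSucc) (v := .cross i k.succ) rfl
    (L.crossPos_strictMono k.castSucc_lt_succ).le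
  rcases Sym2.eq_iff.1 h with ⟨rfl, rfl⟩ | ⟨rfl, rfl⟩
  · exact hk
  · exact hk.trans (add_comm _ _)

theorem exists_mem_subaisle_of_isEnds (L : Layout n b) (i : Fin n) (h : IsEnds k r r') :
    ∃ e ∈ L.subaisle i k, .cross i r ∈ e := by
  refine exists_mem_of_boundary_apply_ne_zero (T := (L.subaisle i k).val) ?_
  rw [boundary_subaisle L i h, Finsupp.add_apply, single_eq_same, single_eq_of_ne, add_zero]
  · exact one_ne_zero
  · exact fun hc => h.ne (Vertex.cross.inj hc).2

theorem subaisle_nonempty (L : Layout n b) (i : Fin n) (k : Fin b) : (L.subaisle i k).Nonempty :=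
  have ⟨e, he, _⟩ := L.exists_mem_subaisle_of_isEnds i (isEnds_castSucc_succ k)
  ⟨e, he⟩

theorem eq_of_mem_subaisle (h : e ∈ L.subaisle i k) (h' : e ∈ L.subaisle j l) :
    i = j ∧ k = l := by
  obtain ⟨u, v, huv, rfl, hu, hv, rfl⟩ := mem_subaisle.1 h
  obtain ⟨x, y, hxy, rfl, hx, hy, he⟩ := mem_subaisle.1 h'
  obtain ⟨rfl, rfl⟩ := huv.eq_of_mk_eq hxy he
  exact ⟨rfl, subaisle_unique (hu.trans_lt huv.2.1) hv (hx.trans_lt huv.2.1) hy⟩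

theorem isEnds_of_cross_mem_subaisle (he : e ∈ L.subaisle j k) (hr : .cross i r ∈ e) :
    i = j ∧ ∃ r', IsEnds k r r' := by
  obtain ⟨x, y, hxy, rfl, hx, hy, rfl⟩ := mem_subaisle.1 he
  obtain ⟨hi, hle, hge⟩ : i = x.aisle ∧ L.crossPos k.castSucc ≤ L.crossPos r ∧
      L.crossPos r ≤ L.crossPos k.succ := by
    rcases Sym2.mem_iff.1 hr with rfl | rfl
    · exact ⟨rfl, hx, hxy.2.1.le.trans hy⟩
    · exact ⟨hxy.1.symm, hx.trans hxy.2.1.le, hy⟩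
  refine ⟨hi, ?_⟩
  rcases L.le_or_ge_of_crossPos r k with h | h
  · exact ⟨k.succ, Sym2.eq_iff.2 (.inl ⟨L.crossPos_strictMono.injective (h.antisymm hle), rfl⟩)⟩
  · exact ⟨k.castSucc,
      Sym2.eq_iff.2 (.inr ⟨L.crossPos_strictMono.injective (hge.antisymm h), rfl⟩)⟩

theorem eq_of_cross_mem_subaisle {e' : Sym2 L.Vertex} (he : e ∈ L.subaisle i k)
    (he' : e' ∈ L.subaisle i k) (hr : .cross j r ∈ e) (hr' : .cross j r ∈ e') : e = e' := by
  obtain ⟨u, v, huv, rfl, hu, hv, rfl⟩ := mem_subaisle.1 he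
  obtain ⟨x, y, hxy, haisle, hx, hy, rfl⟩ := mem_subaisle.1 he'
  have hr_mid : ∀ a c : L.Vertex, L.crossPos k.castSucc ≤ a.pos → a.pos < L.crossPos r →
      L.crossPos r < c.pos → ¬ c.pos ≤ L.crossPos k.succ := by
    intro a c ha har hrc hc
    rcases L.le_or_ge_of_crossPos r k with h | h <;> linarith
  rcases Sym2.mem_iff.1 hr with rfl | rfl <;> rcases Sym2.mem_iff.1 hr' with rfl | rfl
  · rw [(huv.eq_of_le_of_lt hxy haisle.symm le_rfl huv.2.1).2]
  · exact absurd hv (hr_mid x v hx hxy.2.1 huv.2.1)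
  · exact absurd hy (hr_mid u y hu huv.2.1 hxy.2.1)
  · rcases le_total u.pos x.pos with h | h
    · rw [(huv.eq_of_le_of_lt hxy haisle.symm h hxy.2.1).1]
    · rw [(hxy.eq_of_le_of_lt huv haisle h huv.2.1).1]

theorem VertStep.exists_mem_subaisle (h : L.VertStep u v) :
    ∃ k, s(u, v) ∈ L.subaisle u.aisle k := by
  suffices ∃ k : Fin b, L.crossPos k.castSucc ≤ u.pos ∧ u.pos < L.crossPos k.succ by
    obtain ⟨k, hku, huk⟩ := this
    exact ⟨k, mem_subaisle.2 ⟨u, v, h, rfl, hku,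
      not_lt.1 fun hkv => h.2.2 (.cross u.aisle k.succ) rfl ⟨huk, hkv⟩, rfl⟩⟩
  rcases u with ⟨j, s⟩ | ⟨j, l, q, hq⟩
  · have hs : s ≠ Fin.last b := by
      rintro rfl
      exact h.2.1.not_ge v.pos_le_last
    exact ⟨s.castPred hs, le_rfl, L.crossPos_strictMono (s.castPred hs).castSucc_lt_succ⟩
  · exact ⟨l, (L.items_mem j l q hq).1.le, (L.items_mem j l q hq).2⟩

end Subaisle

section CrossAisle

/-- The segment of cross-aisle `r` between the aisles `i` and `j`; it is an edge of the warehouse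
graph if these are consecutive, that is adjacent in `pathGraph n`. -/
def horiz (L : Layout n b) (i j : Fin n) (r : Fin (b + 1)) : Sym2 L.Vertex :=
  s(.cross i r, .cross j r)

theorem horiz_comm (L : Layout n b) (i j : Fin n) (r : Fin (b + 1)) :
    L.horiz i j r = L.horiz j i r := Sym2.eq_swap

theorem horiz_ne_horiz (L : Layout n b) {i' j' : Fin n} (h : r ≠ r') :
    L.horiz i j r ≠ L.horiz i' j' r' := by
  intro he
  rcases Sym2.eq_iff.1 he with ⟨h1, -⟩ | ⟨h1, -⟩ <;> exact h (Vertex.cross.inj h1).2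

theorem horiz_notMem_subaisle {i' : Fin n} (h : i ≠ j) : L.horiz i j r ∉ L.subaisle i' k := by
  intro hmem
  obtain ⟨x, y, hxy, -, -, -, he⟩ := mem_subaisle.1 hmem
  rcases Sym2.eq_iff.1 he with ⟨rfl, rfl⟩ | ⟨rfl, rfl⟩
  exacts [h hxy.1, h hxy.1.symm]

theorem edgeLength_horiz (L : Layout n b) (i j : Fin n) (r : Fin (b + 1)) :
    L.edgeLength (L.horiz i j r) = |L.aislePos i - L.aislePos j| := by
  simp [edgeLength, horiz, Vertex.aisle, Vertex.pos]

theorem horiz_mem_edgeSet (L : Layout n b) (h : (pathGraph n).Adj i j) (r : Fin (b + 1)) :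
    L.horiz i j r ∈ L.graph.edgeSet := by
  rw [horiz, mem_edgeSet, graph, fromRel_adj]
  refine ⟨fun hc => h.ne (Vertex.cross.inj hc).1, ?_⟩
  rcases pathGraph_adj.1 h with h | h
  exacts [.inl (.inr ⟨i, j, r, h, rfl, rfl⟩), .inr (.inr ⟨j, i, r, h, rfl, rfl⟩)]

theorem graph_preconnected (L : Layout n b) : L.graph.Preconnected := by
  intro u v
  have hlast : ∀ x : L.Vertex, L.graph.Reachable x (.cross x.aisle (Fin.last b)) := fun x =>
    reachable_of_aisle_eq rfl x.pos_le_last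
  refine (hlast u).trans (Reachable.trans ?_ (hlast v).symm)
  exact reachable_of_adj_reachable (Vertex.cross · (Fin.last b))
    (fun _ _ hij => (mem_edgeSet _ |>.1 (L.horiz_mem_edgeSet hij _)).reachable)
    (pathGraph_preconnected n u.aisle v.aisle)

theorem mem_edgeSet_graph (he : e ∈ L.graph.edgeSet) :
    (∃ i k, e ∈ L.subaisle i k) ∨ ∃ i j r, (pathGraph n).Adj i j ∧ e = L.horiz i j r := by
  induction e with | _ u v
  rw [mem_edgeSet, graph, fromRel_adj] at he
  rcases he.2 with (h | ⟨i, j, r, h, rfl, rfl⟩) | (h | ⟨i, j, r, h, rfl, rfl⟩)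
  · exact .inl ⟨_, h.exists_mem_subaisle⟩
  · exact .inr ⟨i, j, r, pathGraph_adj.2 (.inl h), rfl⟩
  · exact .inl ⟨_, Sym2.eq_swap ▸ h.exists_mem_subaisle⟩
  · exact .inr ⟨j, i, r, pathGraph_adj.2 (.inr h), rfl⟩

theorem edgeLength_pos (he : e ∈ L.graph.edgeSet) : 0 < L.edgeLength e := by
  rcases mem_edgeSet_graph he with ⟨i, k, h⟩ | ⟨i, j, r, h, rfl⟩
  · obtain ⟨u, v, huv, -, -, -, rfl⟩ := mem_subaisle.1 h
    rw [huv.edgeLength_eq]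
    exact sub_pos.2 huv.2.1
  · rw [edgeLength_horiz, abs_pos, sub_ne_zero]
    exact fun he => h.ne (L.aislePos_strictMono.injective he)

theorem IsOuter.mem_subaisle_or_eq_horiz (hr : IsOuter r) (hk : IsEnds k r r')
    (he : e ∈ L.graph.edgeSet) (hre : .cross i r ∈ e) :
    e ∈ L.subaisle i k ∨ ∃ j, (pathGraph n).Adj i j ∧ e = L.horiz i j r := by
  rcases mem_edgeSet_graph he with ⟨j, l, h⟩ | ⟨j, l, q, h, rfl⟩
  · obtain ⟨rfl, s, hl⟩ := isEnds_of_cross_mem_subaisle h hre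
    exact .inl (hr.eq_of_isEnds hk hl ▸ h)
  · rcases Sym2.mem_iff.1 hre with hc | hc <;> obtain ⟨rfl, rfl⟩ := Vertex.cross.inj hc
    exacts [.inr ⟨l, h, rfl⟩, .inr ⟨j, h.symm, L.horiz_comm _ _ _⟩]

end CrossAisle

section AisleSide

/-- The part of the aisle of `t` that lies on the same side of `t` as the height of `d`.  Here `t`
itself belongs to the upper side, so that the two sides are separated by the step below `t`. -/
def aisleSide (t d : L.Vertex) : Set L.Vertex :=
  {v | v.aisle = t.aisle ∧ (v.pos ≤ t.pos ↔ d.pos ≤ t.pos)}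

theorem VertStep.mk_eq_of_mem_cut_aisleSide {t t' d : L.Vertex} (ht : L.VertStep t t')
    (h : L.VertStep x y) (hcut : s(x, y) ∈ cut (aisleSide t d)) : s(x, y) = s(t, t') := by
  simp only [mk_mem_cut, aisleSide, Set.mem_ofPred_eq, ← h.1] at hcut
  have haisle : x.aisle = t.aisle := by tauto
  have hbetween : x.pos ≤ t.pos ∧ t.pos < y.pos := by
    have hmono : y.pos ≤ t.pos → x.pos ≤ t.pos := h.2.1.le.trans
    rw [← not_le]
    tauto
  obtain ⟨rfl, rfl⟩ := h.eq_of_le_of_lt ht haisle hbetween.1 hbetween.2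
  rfl

theorem VertStep.eq_or_eq_horiz_of_mem_cut_aisleSide {t t' d : L.Vertex} (ht : L.VertStep t t')
    (he : e ∈ L.graph.edgeSet) (hcut : e ∈ cut (aisleSide t d)) :
    e = s(t, t') ∨ ∃ j r, (pathGraph n).Adj t.aisle j ∧ e = L.horiz t.aisle j r ∧
      (L.crossPos r ≤ t.pos ↔ d.pos ≤ t.pos) := by
  rcases mem_edgeSet_graph he with ⟨i, k, h⟩ | ⟨i, j, r, hij, rfl⟩
  · obtain ⟨x, y, hxy, -, -, -, rfl⟩ := mem_subaisle.1 h
    exact .inl (ht.mk_eq_of_mem_cut_aisleSide hxy hcut)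
  · obtain ⟨a, ⟨haisle, hside⟩, c, -, hac⟩ := hcut
    right
    rcases Sym2.eq_iff.1 hac with ⟨rfl, rfl⟩ | ⟨rfl, rfl⟩
    · exact ⟨j, r, haisle ▸ hij, haisle ▸ rfl, hside⟩
    · exact ⟨i, r, haisle ▸ hij.symm, haisle ▸ L.horiz_comm _ _ _, hside⟩

theorem VertStep.crossPos_le_pos_iff (h : L.VertStep u v) (hu : L.crossPos k.castSucc ≤ u.pos)
    (hv : v.pos ≤ L.crossPos k.succ) : L.crossPos r ≤ u.pos ↔ r ≤ k.castSucc := by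
  refine ⟨fun hr => ?_, fun hr => (L.crossPos_strictMono.monotone hr).trans hu⟩
  refine (L.le_or_ge_of_crossPos r k).elim L.crossPos_strictMono.le_iff_le.1 fun hk => ?_
  exact absurd ((h.2.1.trans_le hv).trans_le hk) hr.not_gt

end AisleSide

section Elbow

/-- The elbow formed by subaisle `k` of aisle `i` and the edge of cross-aisle `r` towards aisle `j`.
If `r` is an end of `k`, this is one of the two ways around a rectangle whose horizontal sides are
the edges between the aisles `i` and `j`. -/
noncomputable def elbow (L : Layout n b) (i j : Fin n) (k : Fin b) (r : Fin (b + 1)) :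
    Multiset (Sym2 L.Vertex) :=
  (L.subaisle i k).val + {L.horiz i j r}

theorem mem_elbow : e ∈ L.elbow i j k r ↔ e ∈ L.subaisle i k ∨ e = L.horiz i j r := by
  simp [elbow]

theorem elbow_nodup (hij : i ≠ j) : (L.elbow i j k r).Nodup :=
  Multiset.nodup_add.2 ⟨Finset.nodup _, Multiset.nodup_singleton _,
    Multiset.disjoint_singleton.2 (horiz_notMem_subaisle hij)⟩

theorem elbow_subset_edgeSet (hij : (pathGraph n).Adj i j) (he : e ∈ L.elbow i j k r) :
    e ∈ L.graph.edgeSet := by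
  rcases mem_elbow.1 he with he | rfl
  exacts [subaisle_subset_edgeSet he, L.horiz_mem_edgeSet hij r]

theorem sum_edgeLength_elbow_comm (L : Layout n b) (i j : Fin n) (k : Fin b)
    (r r' : Fin (b + 1)) :
    ((L.elbow i j k r).map L.edgeLength).sum = ((L.elbow j i k r').map L.edgeLength).sum := by
  simp only [elbow, Multiset.map_add, Multiset.sum_add, Finset.sum_map_val,
    sum_edgeLength_subaisle, Multiset.map_singleton, Multiset.sum_singleton, edgeLength_horiz,
    abs_sub_comm (L.aislePos i)]

theorem boundary_elbow (L : Layout n b) (i j : Fin n) (h : IsEnds k r r') :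
    boundary (L.elbow i j k r) = single (.cross i r') 1 + single (.cross j r) 1 := by
  rw [elbow, map_add, L.boundary_subaisle i h.symm, horiz, boundary_singleton, add_assoc,
    ← add_assoc (single (Vertex.cross i r) 1), ZModModule.add_self, zero_add]

theorem boundary_elbow_comm (L : Layout n b) (i j : Fin n) (h : IsEnds k r r') :
    boundary (L.elbow i j k r) = boundary (L.elbow j i k r') := by
  rw [L.boundary_elbow i j h, L.boundary_elbow j i h.symm, add_comm]

end Elbow

end Layout

namespace Warehouse

open Layout

variable {n b : ℕ} {W : Warehouse n b} {T R : Multiset (Sym2 W.Vertex)} {e : Sym2 W.Vertex}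
  {i j : Fin n} {k : Fin b} {r r' : Fin (b + 1)}

section Optimal

/-- A shortest even connector between the depot and the other pick locations.  By Euler's theorem
this is a minimal tour, but it is easier to modify locally. -/
abbrev IsShort (W : Warehouse n b) (T : Multiset (Sym2 W.Vertex)) : Prop :=
  MinimalFor (IsEvenConnector W.graph W.depot {v | W.IsPickLocation v}) W.length T

theorem IsShort.minimal (hT : W.IsShort T) :
    Minimal (IsEvenConnector W.graph W.depot {v | W.IsPickLocation v}) T :=
  hT.minimal_of_strictMonoOn (strictMonoOn_sum_map fun _ => edgeLength_pos)

theorem IsShort.isMinimalTour (hT : W.IsShort T) : W.IsMinimalTour T := by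
  refine ⟨exists_walk_edges_eq_of_minimal hT.minimal, ?_⟩
  rintro _ ⟨w, hw, rfl⟩
  exact hT.le (isEvenConnector_walk_edges w hw)

theorem exists_isShort (W : Warehouse n b) : ∃ T, W.IsShort T :=
  exists_minimalFor_sum (fun _ => edgeLength_pos) fun v _ => W.graph_preconnected W.depot v

open Classical in
/-- The subaisles that are traversed twice by `T`, as pairs of an aisle and a block. -/
def doubled (W : Warehouse n b) (T : Multiset (Sym2 W.Vertex)) : Set (Fin n × Fin b) :=
  {x | ∀ e ∈ W.subaisle x.1 x.2, 2 ≤ T.count e}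

theorem exists_mem_doubled (h : ¬ W.NoDoubleEdge T) : ∃ i k, (i, k) ∈ W.doubled T := by
  simp only [NoDoubleEdge, not_forall, not_not] at h
  obtain ⟨i, r, s, hrs, hcount, -⟩ := h
  refine ⟨i, r.castPred (Fin.ne_last_of_lt hrs), fun e he => ?_⟩
  obtain ⟨u, v, huv, hi, hu, hv, rfl⟩ := mem_subaisle.1 he
  refine hcount u v huv hi hu (hv.trans (W.crossPos_strictMono.monotone ?_))
  exact Fin.castSucc_lt_iff_succ_le.1 hrs

/-- A shortest even connector with as few doubled subaisles as possible. -/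
abbrev IsOptimal (W : Warehouse n b) (T : Multiset (Sym2 W.Vertex)) : Prop :=
  MinimalFor W.IsShort (fun T => (W.doubled T).ncard) T

theorem exists_isOptimal (W : Warehouse n b) : ∃ T, W.IsOptimal T :=
  exists_minimalFor_of_wellFoundedLT _ _ W.exists_isShort

theorem IsShort.cross_eq_depot_of_horiz_notMem (hT : W.IsShort T) (hd : (i, k) ∈ W.doubled T)
    (hr : IsOuter r) (hk : IsEnds k r r')
    (hhoriz : ∀ j, (pathGraph n).Adj i j → W.horiz i j r ∉ T) : .cross i r = W.depot := by
  by_contra hne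
  obtain ⟨e, he, hre⟩ := W.exists_mem_subaisle_of_isEnds i hk
  have hpendant : ∀ e' ∈ T, .cross i r ∈ e' → e' = e := by
    intro e' he' hre'
    rcases hr.mem_subaisle_or_eq_horiz hk (hT.prop.mem_edgeSet e' he') hre' with h | ⟨j, hij, rfl⟩
    · exact eq_of_cross_mem_subaisle h he hre' hre
    · exact absurd he' (hhoriz j hij)
  rcases mem_of_pendant_of_two_le_count hT.minimal (hd e he) hre hpendant hne with
    h | ⟨_, _, _, _, h⟩
  · exact hne h
  · cases h

end Optimal

section Swap

theorem exists_eq_add_elbow (hd : (i, k) ∈ W.doubled T) (hij : i ≠ j)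
    (hh : W.horiz i j r ∈ T) : ∃ R, T = R + W.elbow i j k r := by
  classical
  suffices W.elbow i j k r ≤ T by
    obtain ⟨R, rfl⟩ := Multiset.le_iff_exists_add.1 this
    exact ⟨R, add_comm _ _⟩
  rw [Multiset.le_iff_subset (elbow_nodup hij)]
  intro e he
  rcases mem_elbow.1 he with he | rfl
  · exact Multiset.count_pos.1 (two_pos.trans_le (hd e he))
  · exact hh

theorem subaisle_subset_of_mem_doubled (hij : i ≠ j)
    (hd : (i, k) ∈ W.doubled (R + W.elbow i j k r)) (he : e ∈ W.subaisle i k) : e ∈ R := by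
  classical
  have hcount := hd e he
  rw [Multiset.count_add, Multiset.count_eq_one_of_mem (elbow_nodup hij) (mem_elbow.2 (.inl he))]
    at hcount
  exact Multiset.count_pos.1 (by omega)

theorem reachable_add_elbow (hk : IsEnds k r r') (hR : ∀ e ∈ W.subaisle i k, e ∈ R) :
    (usedGraph (R + W.elbow j i k r')).Reachable (.cross i r) (.cross j r) := by
  have hdetour : boundary ((W.subaisle i k).val + W.elbow j i k r') =
      single (.cross i r) 1 + single (.cross j r) 1 := by
    rw [map_add, W.boundary_subaisle i hk, W.boundary_elbow j i hk.symm,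
      add_comm (single (Vertex.cross j r) 1), add_assoc, ← add_assoc (single (Vertex.cross i r') 1),
      ZModModule.add_self, zero_add]
  refine (reachable_usedGraph_of_boundary_eq hdetour).mono (usedGraph_mono fun e he => ?_)
  exact Multiset.mem_add.2 ((Multiset.mem_add.1 he).imp_left (hR e))

theorem IsShort.swap_elbow (hT : W.IsShort (R + W.elbow i j k r))
    (hR : ∀ e ∈ W.subaisle i k, e ∈ R) (hij : (pathGraph n).Adj i j) (hk : IsEnds k r r') :
    W.IsShort (R + W.elbow j i k r') := by
  have hreach := reachable_add_elbow (j := j) hk hR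
  refine ⟨hT.prop.exchange (fun e => elbow_subset_edgeSet hij.symm)
    (W.boundary_elbow_comm i j hk) fun x y hxy => ?_, fun T' hT' _ => ?_⟩
  · rcases mem_elbow.1 hxy with h | h
    · exact reachable_usedGraph_of_mem (Multiset.mem_add.2 (.inl (hR _ h)))
    · obtain ⟨rfl, rfl⟩ | ⟨rfl, rfl⟩ := Sym2.eq_iff.1 h
      exacts [hreach, hreach.symm]
  · have hlength : W.length (R + W.elbow j i k r') = W.length (R + W.elbow i j k r) := by
      simp only [length, Multiset.map_add, Multiset.sum_add,
        W.sum_edgeLength_elbow_comm j i k r' r]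
    exact hlength.trans_le (hT.le hT')

theorem doubled_swap_elbow_subset (hT : W.IsShort (R + W.elbow i j k r)) (hij : i ≠ j) :
    W.doubled (R + W.elbow j i k r') ⊆
      insert (j, k) (W.doubled (R + W.elbow i j k r) \ {(i, k)}) := by
  classical
  rintro ⟨i', k'⟩ hd
  refine or_iff_not_imp_left.2 fun hne => ?_
  have hdR : ∀ e ∈ W.subaisle i' k', 2 ≤ R.count e := by
    intro e he
    have helbow : e ∉ W.elbow j i k r' := by
      rw [mem_elbow, not_or]
      refine ⟨fun h => hne ?_, fun h => horiz_notMem_subaisle hij.symm (h ▸ he)⟩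
      exact Prod.ext_iff.2 (eq_of_mem_subaisle he h)
    simpa only [Multiset.count_add, Multiset.count_eq_zero_of_notMem helbow, add_zero] using hd e he
  refine ⟨fun e he => ?_, ?_⟩
  · exact (hdR e he).trans (Multiset.count_le_of_le e (Multiset.le_add_right R _))
  · intro hik
    obtain ⟨rfl, rfl⟩ := Prod.mk.inj hik
    obtain ⟨e, he⟩ := W.subaisle_nonempty i' k'
    have htwo := count_le_two_of_minimal hT.minimal e
    rw [Multiset.count_add, Multiset.count_eq_one_of_mem (elbow_nodup hij) (mem_elbow.2 (.inl he))]
      at htwo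
    have := hdR e he
    omega

theorem IsOptimal.swap_elbow (hT : W.IsOptimal (R + W.elbow i j k r))
    (hd : (i, k) ∈ W.doubled (R + W.elbow i j k r)) (hij : (pathGraph n).Adj i j)
    (hk : IsEnds k r r') :
    W.IsOptimal (R + W.elbow j i k r') ∧ (j, k) ∈ W.doubled (R + W.elbow j i k r') := by
  have hshort : W.IsShort (R + W.elbow j i k r') :=
    hT.prop.swap_elbow (fun _ => subaisle_subset_of_mem_doubled hij.ne hd) hij hk
  have hsub := doubled_swap_elbow_subset (r' := r') hT.prop hij.ne
  have hlt := Set.ncard_sdiff_singleton_lt_of_mem hd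
  refine ⟨⟨hshort, fun T' hT' _ => ?_⟩, ?_⟩
  · calc (W.doubled (R + W.elbow j i k r')).ncard
        ≤ (insert (j, k) (W.doubled (R + W.elbow i j k r) \ {(i, k)})).ncard :=
          Set.ncard_le_ncard hsub
      _ ≤ (W.doubled (R + W.elbow i j k r) \ {(i, k)}).ncard + 1 := Set.ncard_insert_le _ _
      _ ≤ (W.doubled (R + W.elbow i j k r)).ncard := hlt
      _ ≤ (W.doubled T').ncard := hT.le hT'
  · by_contra hjk
    rw [Set.subset_insert_iff_of_notMem hjk] at hsub
    exact (hT.le hshort).not_gt ((Set.ncard_le_ncard hsub).trans_lt hlt)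

/-- Otherwise the two elbows would form a rectangle of used edges, none of which is a bridge. -/
theorem IsShort.horiz_notMem_of_mem_doubled (hT : W.IsShort (R + W.elbow j i k r'))
    (hd : (j, k) ∈ W.doubled (R + W.elbow j i k r')) (hR : ∀ e ∈ W.subaisle i k, e ∈ R)
    (hij : i ≠ j) (hk : IsEnds k r r') : W.horiz i j r ∉ R := by
  classical
  intro hh
  obtain ⟨e, he⟩ := W.subaisle_nonempty j k
  have hrect : boundary (W.elbow i j k r + W.elbow j i k r') = 0 := by
    rw [map_add, W.boundary_elbow_comm i j hk, ZModModule.add_self]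
  have hused : W.elbow i j k r + W.elbow j i k r' ⊆ R + W.elbow j i k r' := fun e' he' =>
    Multiset.mem_add.2 <| (Multiset.mem_add.1 he').imp_left fun h =>
      (mem_elbow.1 h).elim (hR e') fun h => h ▸ hh
  have heven := even_count_of_isBridge (isBridge_of_two_le_count hT.minimal (hd e he)) hused hrect
  have helbow : e ∉ W.elbow i j k r := by
    rw [mem_elbow, not_or]
    exact ⟨fun h => hij (eq_of_mem_subaisle h he).1, fun h => horiz_notMem_subaisle hij (h ▸ he)⟩
  rw [Multiset.count_add, Multiset.count_eq_zero_of_notMem helbow,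
    Multiset.count_eq_one_of_mem (elbow_nodup hij.symm) (mem_elbow.2 (.inl he))] at heven
  exact absurd heven (by decide)

open Classical in
theorem IsOptimal.exists_swap (hT : W.IsOptimal T) (hd : (i, k) ∈ W.doubled T)
    (hij : (pathGraph n).Adj i j) (hk : IsEnds k r r') (hh : W.horiz i j r ∈ T) :
    T.count (W.horiz i j r) = 1 ∧
      ∃ T', W.IsOptimal T' ∧ (j, k) ∈ W.doubled T' ∧ W.horiz i j r ∉ T' := by
  obtain ⟨R, rfl⟩ := exists_eq_add_elbow hd hij.ne hh
  obtain ⟨hT', hd'⟩ := hT.swap_elbow hd hij hk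
  have hhR : W.horiz i j r ∉ R := hT'.prop.horiz_notMem_of_mem_doubled hd'
    (fun _ => subaisle_subset_of_mem_doubled hij.ne hd) hij.ne hk
  refine ⟨?_, _, hT', hd', ?_⟩
  · rw [Multiset.count_add, Multiset.count_eq_zero_of_notMem hhR,
      Multiset.count_eq_one_of_mem (elbow_nodup hij.ne) (mem_elbow.2 (.inr rfl))]
  · rw [Multiset.mem_add, mem_elbow, not_or, not_or]
    exact ⟨hhR, horiz_notMem_subaisle hij.ne, W.horiz_ne_horiz hk.ne⟩

end Swap

section OuterEnd

theorem IsOptimal.exists_ne_horiz_mem (hT : W.IsOptimal T) (hd : (i, k) ∈ W.doubled T)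
    (hr : IsOuter r) (hk : IsEnds k r r') (hij : (pathGraph n).Adj i j)
    (hh : W.horiz i j r ∈ T) :
    ∃ j', j' ≠ j ∧ (pathGraph n).Adj i j' ∧ W.horiz i j' r ∈ T := by
  classical
  have hcut : W.horiz i j r ∈ cut {.cross i r} :=
    ⟨_, rfl, _, fun hc => hij.ne' (Vertex.cross.inj hc).1, rfl⟩
  have hone := (hT.exists_swap hd hij hk hh).1
  obtain ⟨e, he, hne, hodd⟩ := exists_odd_count_of_mem_cut hT.prop.prop.boundary_eq_zero hcut
    (hone ▸ odd_one)
  have heT : e ∈ T := Multiset.count_pos.1 hodd.pos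
  rcases hr.mem_subaisle_or_eq_horiz hk (hT.prop.prop.mem_edgeSet e heT)
    (mem_of_mem_cut_singleton he) with h | ⟨j', hij', rfl⟩
  · have htwo := (count_le_two_of_minimal hT.prop.minimal e).antisymm (hd e h)
    rw [htwo] at hodd
    exact absurd hodd (by decide)
  · exact ⟨j', fun h => hne (h ▸ rfl), hij', heT⟩

theorem IsOptimal.cross_eq_depot_of_horiz_mem (hT : W.IsOptimal T) (hd : (i, k) ∈ W.doubled T)
    (hr : IsOuter r) (hk : IsEnds k r r') (hij : (pathGraph n).Adj i j)
    (hh : W.horiz i j r ∈ T) : .cross j r = W.depot := by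
  obtain ⟨-, T', hT', hd', hhT'⟩ := hT.exists_swap hd hij hk hh
  refine hT'.prop.cross_eq_depot_of_horiz_notMem hd' hr hk fun l hjl hl => ?_
  obtain ⟨l', hne, hjl', hl'⟩ := hT'.exists_ne_horiz_mem hd' hr hk hjl hl
  rw [horiz_comm] at hhT'
  have hli : l ≠ i := fun h => hhT' (h ▸ hl)
  have hli' : l' ≠ i := fun h => hhT' (h ▸ hl')
  rw [pathGraph_adj] at hij hjl hjl'
  omega

theorem IsOptimal.cross_eq_depot (hT : W.IsOptimal T) (hd : (i, k) ∈ W.doubled T)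
    (hr : IsOuter r) (hk : IsEnds k r r') : .cross i r = W.depot := by
  refine hT.prop.cross_eq_depot_of_horiz_notMem hd hr hk fun j hij hh => ?_
  obtain ⟨j', hne, hij', hh'⟩ := hT.exists_ne_horiz_mem hd hr hk hij hh
  have hj := hT.cross_eq_depot_of_horiz_mem hd hr hk hij hh
  have hj' := hT.cross_eq_depot_of_horiz_mem hd hr hk hij' hh'
  exact hne (Vertex.cross.inj (hj'.trans hj.symm)).1

theorem IsOptimal.horiz_notMem {q q' : Fin (b + 1)} (hT : W.IsOptimal T)
    (hd : (i, k) ∈ W.doubled T) (hr : IsOuter r) (hk : IsEnds k r r') (hq : IsEnds k q q')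
    (hij : (pathGraph n).Adj i j) : W.horiz i j q ∉ T := by
  intro hh
  obtain ⟨-, T', hT', hd', -⟩ := hT.exists_swap hd hij hq hh
  have hi := hT.cross_eq_depot hd hr hk
  have hj := hT'.cross_eq_depot hd' hr hk
  exact hij.ne (Vertex.cross.inj (hi.trans hj.symm)).1

end OuterEnd

section Blocks

theorem IsOptimal.noDoubleEdge_of_one_block {W : Warehouse n 1} {T : Multiset (Sym2 W.Vertex)}
    (hT : W.IsOptimal T) : W.NoDoubleEdge T := by
  by_contra h
  obtain ⟨i, k, hd⟩ := exists_mem_doubled h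
  obtain rfl := Subsingleton.elim k 0
  have hk := isEnds_castSucc_succ (0 : Fin 1)
  have hfirst := hT.cross_eq_depot hd (.inl rfl) hk
  have hlast := hT.cross_eq_depot hd (.inr rfl) hk.symm
  exact hk.ne (Vertex.cross.inj (hfirst.trans hlast.symm)).2

open Classical in
theorem IsShort.aisle_eq_of_isPickLocation {t t' v : W.Vertex} (hT : W.IsShort T)
    (ht : W.VertStep t t') (hcount : T.count s(t, t') < 2) (hdepot : W.depot.aisle = t.aisle)
    (hhoriz : ∀ j r, (pathGraph n).Adj t.aisle j → W.horiz t.aisle j r ∈ T →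
      ¬ (W.crossPos r ≤ t.pos ↔ W.depot.pos ≤ t.pos))
    (hv : W.IsPickLocation v) : v.aisle = t.aisle := by
  have hcut : ∀ e ∈ T, e ∈ cut (aisleSide t W.depot) → e = s(t, t') := by
    intro e he hcut
    rcases ht.eq_or_eq_horiz_of_mem_cut_aisleSide (hT.prop.mem_edgeSet e he) hcut with
      h | ⟨j, r, hj, rfl, hside⟩
    · exact h
    · exact absurd hside (hhoriz j r hj he)
  exact (hT.prop.subset_of_cut (A := aisleSide t W.depot) ⟨hdepot, Iff.rfl⟩ hcut hcount hv).1

theorem exists_opposite_subaisle (k : Fin 2) : ∃ (l : Fin 2) (r r' : Fin 3),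
    IsEnds k r 1 ∧ IsEnds l r' 1 ∧ IsOuter r ∧ IsOuter r' ∧ (∀ q, q = r ∨ q = 1 ∨ q = r') ∧
      ¬ (r' ≤ l.castSucc ↔ r ≤ l.castSucc) := by
  unfold IsEnds IsOuter
  fin_cases k
  · exact ⟨1, 0, 2, by decide⟩
  · exact ⟨0, 2, 0, by decide⟩

theorem IsOptimal.exists_aisle_eq {W : Warehouse n 2} {T : Multiset (Sym2 W.Vertex)}
    (hT : W.IsOptimal T) (h : ¬ W.NoDoubleEdge T) :
    ∃ i, ∀ v, W.IsPickLocation v → v.aisle = i := by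
  classical
  obtain ⟨i, k, hd⟩ := exists_mem_doubled h
  obtain ⟨l, r, r', hk, hl, hr, hr', hcases, hside⟩ := exists_opposite_subaisle k
  have hdepot := hT.cross_eq_depot hd hr hk
  have hld : (i, l) ∉ W.doubled T := by
    intro hld
    obtain rfl := (Vertex.cross.inj (hdepot.trans (hT.cross_eq_depot hld hr' hl).symm)).2
    exact hside Iff.rfl
  simp only [doubled, Set.mem_ofPred_eq, not_forall, not_le] at hld
  obtain ⟨e, he, hlt⟩ := hld
  obtain ⟨t, t', ht, rfl, hlt', htl, rfl⟩ := mem_subaisle.1 he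
  refine ⟨t.aisle, fun v => hT.prop.aisle_eq_of_isPickLocation ht hlt (by rw [← hdepot]; rfl)
    fun j q hj hq => ?_⟩
  rcases hcases q with rfl | rfl | rfl
  · exact absurd hq (hT.horiz_notMem hd hr hk hk hj)
  · exact absurd hq (hT.horiz_notMem hd hr hk hk.symm hj)
  · rw [← hdepot, Vertex.pos, ht.crossPos_le_pos_iff hlt' htl, ht.crossPos_le_pos_iff hlt' htl]
    exact hside

theorem IsOptimal.noDoubleEdge_of_two_blocks {W : Warehouse n 2} {T : Multiset (Sym2 W.Vertex)}
    (hT : W.IsOptimal T) (hij : i ≠ j) (hi : W.NonemptyAisle i) (hj : W.NonemptyAisle j) :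
    W.NoDoubleEdge T := by
  by_contra h
  obtain ⟨i₀, hi₀⟩ := hT.exists_aisle_eq h
  obtain ⟨v, hv, rfl⟩ := hi
  obtain ⟨v', hv', rfl⟩ := hj
  exact hij ((hi₀ v hv).trans (hi₀ v' hv').symm)

end Blocks

end Warehouse

end Picker

theorem mainTheorem2 :
    (∀ (n : ℕ) (W : Picker.Warehouse n 1),
      ∃ T, W.IsMinimalTour T ∧ W.NoDoubleEdge T) ∧
    (∀ (n : ℕ) (W : Picker.Warehouse n 2),
      (∃ i j : Fin n, i ≠ j ∧ W.NonemptyAisle i ∧ W.NonemptyAisle j) →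
      ∃ T, W.IsMinimalTour T ∧ W.NoDoubleEdge T) := by
  refine ⟨fun n W => ?_, fun n W ⟨i, j, hij, hi, hj⟩ => ?_⟩
  · obtain ⟨T, hT⟩ := W.exists_isOptimal
    exact ⟨T, hT.prop.isMinimalTour, hT.noDoubleEdge_of_one_block⟩
  · obtain ⟨T, hT⟩ := W.exists_isOptimal
    exact ⟨T, hT.prop.isMinimalTour, hT.noDoubleEdge_of_two_blocks hij hi hj⟩
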